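/- There is a universal constant $C>0$ such that the following holds. Let $d\ge 1$, $N\ge 2$ and $m>dN$ be integers, let $\sigma,K>0$, $\mu\ge 1$ and $R\ge\alpha$ be real numbers. For an order-$d$ tensor $X\in\mathbb{R}^{N\times\cdots\times N}$ let $\|X\|_\infty=\max_\omega|X(\omega)|$, $\|X\|_F^2=\sum_\omega X(\omega)^2$, and let $$\|X\|_M=\inf\{t>0:\ X\in t\,\mathrm{conv}(T_\pm)\},\qquad T_\pm=\{U\in\{\pm1\}^{N\times\cdots\times N}:\ \mathrm{rank}(U)=1\},$$ be the atomic M-norm. Let $T^\sharp$ be an order-$d$ tensor of this size with $\|T^\sharp\|_\infty\le\alpha$ and $\|T^\sharp\|_M\le R$. Let $\omega_1,\dots,\omega_m\in[N]^d$ be i.i.d. random multi-indices with a distribution $\pi$ such that $\pi_\omega\ge\frac{1}{\mu N^d}$ for all $\omega\in[N]^d$, and let $$Y_{\omega_t}=T^\sharp(\omega_t)+\sigma\xi_t,\qquad t=1,\dots,m,$$ where the $\xi_t$ are independent, mean-zero, sub-exponential random variables, independent of $(\omega_t)_t$, with $\max_t\mathbb{E}\exp(|\xi_t|/K)\le e$.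 Let $$\hat T_M\in\arg\min\Big\{\frac1m\sum_{t=1}^m (X(\omega_t)-Y_{\omega_t})^2:\ \|X\|_\infty\le\alpha,\ \|X\|_M\le R\Big\}.$$ Then, with probability greater than $1-2e^{-N/\ln N}$, $$\frac{1}{N^d}\|\hat T_M-T^\sharp\|_F^2\le C\,\mu\,(\alpha+\sigma K)\,R\,\sqrt{\frac{dN}{m}}.$$ -/

import Mathlib

open MeasureTheory ProbabilityTheory

noncomputable section

/-- Real tensors of order `d` all of whose `d` sizes equal `N`, as functions of the multi-index.
The norm `‖T‖` of this function type is the entrywise supremum norm `max_i |T i|`. -/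
abbrev Tensor (d N : ℕ) : Type := (Fin d → Fin N) → ℝ

/-- The outer product `u₁ ∘ ⋯ ∘ u_d` of `d` vectors of length `N`. -/
def outerProduct {d N : ℕ} (u : Fin d → Fin N → ℝ) : Tensor d N :=
  fun i => ∏ j, u j (i j)

/-- The (CP) rank: the least number of scalar multiples of outer products of vectors whose sum
is `T`. (Normalizing the vectors changes nothing, the scalars absorb their norms.) -/
def tensorRank {d N : ℕ} (T : Tensor d N) : ℕ :=
  sInf {r : ℕ | ∃ (c : Fin r → ℝ) (u : Fin r → Fin d → Fin N → ℝ),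
    T = ∑ k, c k • outerProduct (u k)}

/-- The set of sign tensors of rank one. -/
def signAtoms (d N : ℕ) : Set (Tensor d N) :=
  {T | (∀ i, T i = 1 ∨ T i = -1) ∧ tensorRank T = 1}

/-- The atomic M-norm: the gauge `inf {t > 0 | T ∈ t • conv (signAtoms)}`. -/
def mNorm {d N : ℕ} (T : Tensor d N) : ℝ :=
  gauge (convexHull ℝ (signAtoms d N)) T

/-- Tensors with entries bounded by `α` in absolute value and with M-norm at most `R`. -/
def mNormBall (d N : ℕ) (α R : ℝ) : Set (Tensor d N) :=
  {T | ‖T‖ ≤ α ∧ mNorm T ≤ R}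

/-- The squared Frobenius norm. -/
def frobeniusSq {d N : ℕ} (T : Tensor d N) : ℝ := ∑ i, T i ^ 2

/-- The empirical least squares loss `(1/m) ∑ₜ (X (ω t) - y t)²` of `X`, given the sampled
multi-indices `ω` and the observed values `y`. -/
def empiricalLoss {d N m : ℕ} (ω : Fin m → Fin d → Fin N) (y : Fin m → ℝ) (X : Tensor d N) : ℝ :=
  (1 / (m : ℝ)) * ∑ t, (X (ω t) - y t) ^ 2

/-- `X` minimizes the empirical loss over `mNormBall d N α R`. -/
def IsMNormEstimator {d N m : ℕ} (α R : ℝ) (ω : Fin m → Fin d → Fin N) (y : Fin m → ℝ)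
    (X : Tensor d N) : Prop :=
  X ∈ mNormBall d N α R ∧ IsMinOn (empiricalLoss ω y) (mNormBall d N α R) X

/-- The random variable `X` is sub-exponential with constant `K`: `𝔼 exp (|X| / K)` exists and is
at most `e`. -/
def IsSubExponential {S : Type*} [MeasurableSpace S] (P : Measure S) (X : S → ℝ) (K : ℝ) : Prop :=
  Integrable (fun s => Real.exp (|X s| / K)) P ∧ ∫ s, Real.exp (|X s| / K) ∂P ≤ Real.exp 1

end

/-!
The basic inequality of least squares reads, for the error `D = That - T` and the sampled
multi-indices `ω t`,

  `∑ₜ D (ω t) ^ 2 ≤ 2 * σ * ∑ₜ ξ t * D (ω t)`.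

Both sides are controlled uniformly over the M-norm ball.

* Noise. `D` is a difference of two tensors of M-norm at most `R`, so a linear functional of `D` is
  at most `2 * R` times its maximum over rank-one sign tensors (`sum_mul_sub_le_of_mNorm_le`). There
  are at most `exp (2 * d * N)` of these, and for each of them the noise sum has a Bernstein tail; a
  union bound gives `measureReal_noise_gt_le`.
* Quadratic process. The sum `∑ₜ D (ω t) ^ 2` must not fall far below its mean. A bound on the
  exponential moment of the largest deviation (`exp_moment_sq_deviation_le`) follows from
  symmetrization with an independent copy of the sample (`exp_moment_iSup_le_rademacher`), from
  contraction (`sum_exp_iSup_rademacher_le`), which replaces `D ^ 2` by a multiple of `α * D`, and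
  from the same duality with sign tensors, which leaves finitely many Rademacher sums. Chernoff's
  bound then gives `measureReal_sq_deviation_gt_le`, without any separate concentration inequality.
  The sample takes finitely many values, so these moments are finite sums and the suprema over the
  ball raise no measurability question.

With deviation levels of order `K * √(d * N * m)` and `α * R * √(d * N * m)` each exceptional event
has probability at most `exp (-2 * d * N) < exp (-N / log N)`. The lower bound on the sampling
distribution compares the mean of `D (ω t) ^ 2` with the Frobenius norm.
-/

/-! ### Sign tensors of rank one and the M-norm -/

/-- The sign `1` or `-1` encoded by a Boolean. -/
def boolSign (b : Bool) : ℝ := if b then 1 else -1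

@[simp] lemma boolSign_true : boolSign true = 1 := by simp [boolSign]

@[simp] lemma boolSign_false : boolSign false = -1 := by simp [boolSign]

lemma boolSign_not (b : Bool) : boolSign (!b) = -boolSign b := by cases b <;> simp

lemma abs_boolSign (b : Bool) : |boolSign b| = 1 := by cases b <;> simp

/-- The rank-one sign tensor with a global sign and `d` sign vectors, all encoded by Booleans. -/
def signTensor {d N : ℕ} (u : Bool × (Fin d → Fin N → Bool)) : Tensor d N :=
  boolSign u.1 • outerProduct fun j k => boolSign (u.2 j k)

lemma signTensor_not {d N : ℕ} (b : Bool) (u : Fin d → Fin N → Bool) :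
    signTensor (!b, u) = -signTensor (b, u) := by
  simp [signTensor, boolSign_not]

lemma abs_signTensor {d N : ℕ} (u : Bool × (Fin d → Fin N → Bool)) (i : Fin d → Fin N) :
    |signTensor u i| = 1 := by
  simp [signTensor, outerProduct, abs_mul, Finset.abs_prod, abs_boolSign]

lemma signTensor_mem_signAtoms {d N : ℕ} [NeZero N] (u : Bool × (Fin d → Fin N → Bool)) :
    signTensor u ∈ signAtoms d N := by
  refine ⟨fun i => eq_or_eq_neg_of_abs_eq (abs_signTensor u i), ?_⟩
  have h1 : 1 ∈ {r : ℕ | ∃ (c : Fin r → ℝ) (v : Fin r → Fin d → Fin N → ℝ),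
      signTensor u = ∑ k, c k • outerProduct (v k)} :=
    ⟨fun _ => boolSign u.1, fun _ j k => boolSign (u.2 j k), by simp [signTensor]⟩
  refine le_antisymm (Nat.sInf_le h1) (Nat.one_le_iff_ne_zero.2 fun h0 => ?_)
  have hmem := Nat.sInf_mem ⟨1, h1⟩
  rw [show sInf _ = 0 from h0] at hmem
  obtain ⟨c, v, h⟩ := hmem
  have := abs_signTensor u fun _ => 0
  rw [h] at this
  simp at this

lemma exists_signTensor_of_mem_signAtoms {d N : ℕ} {T : Tensor d N} (hT : T ∈ signAtoms d N) :
    ∃ u, T = signTensor u := by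
  obtain ⟨hs, hr⟩ := hT
  have hne : {r : ℕ | ∃ (c : Fin r → ℝ) (v : Fin r → Fin d → Fin N → ℝ),
      T = ∑ k, c k • outerProduct (v k)}.Nonempty := by
    by_contra h
    rw [Set.not_nonempty_iff_eq_empty] at h
    simp [tensorRank, h] at hr
  have hmem := Nat.sInf_mem hne
  rw [show sInf _ = 1 from hr] at hmem
  obtain ⟨c, v, h⟩ := hmem
  have hval : ∀ i, T i = c 0 * ∏ j, v 0 j (i j) := fun i => by
    rw [h]; simp [outerProduct]
  have hsign : ∀ x : ℝ, boolSign (decide (0 ≤ x)) * |x| = x := fun x => by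
    by_cases hx : 0 ≤ x
    · simp [hx, abs_of_nonneg hx]
    · simp [hx, abs_of_neg (not_le.1 hx)]
  refine ⟨(decide (0 ≤ c 0), fun j k => decide (0 ≤ v 0 j k)), funext fun i => ?_⟩
  have habs : |c 0| * ∏ j, |v 0 j (i j)| = 1 := by
    rw [← Finset.abs_prod, ← abs_mul, ← hval]
    rcases hs i with h | h <;> simp [h]
  calc T i = (boolSign (decide (0 ≤ c 0)) * |c 0|) *
        ∏ j, (boolSign (decide (0 ≤ v 0 j (i j))) * |v 0 j (i j)|) := by
          simp only [hsign]; exact hval i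
    _ = (boolSign (decide (0 ≤ c 0)) * ∏ j, boolSign (decide (0 ≤ v 0 j (i j)))) *
        (|c 0| * ∏ j, |v 0 j (i j)|) := by rw [Finset.prod_mul_distrib]; ring
    _ = _ := by rw [habs, mul_one]; simp [signTensor, outerProduct]

/-- The tensor with a single nonzero entry is the average of `2 ^ d` rank-one sign tensors: each
of its factors is the average of two sign vectors. -/
lemma single_eq_sum_signTensor {d N : ℕ} (i : Fin d → Fin N) :
    (Pi.single i 1 : Tensor d N) =
      ∑ δ : Fin d → Bool, (1 / 2 : ℝ) ^ d • signTensor (true, fun j k => δ j || decide (k = i j)) := by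
  ext x
  have hfac : ∀ j, (if x j = i j then (1 : ℝ) else 0) =
      ∑ b : Bool, 1 / 2 * boolSign (b || decide (x j = i j)) := fun j => by
    by_cases h : x j = i j <;> norm_num [h]
  calc (Pi.single i 1 : Tensor d N) x = ∏ j, (if x j = i j then (1 : ℝ) else 0) := by
        rw [Finset.prod_ite_zero]
        simp [Pi.single_apply, funext_iff]
    _ = ∑ δ : Fin d → Bool, ∏ j, 1 / 2 * boolSign (δ j || decide (x j = i j)) := by
        simp_rw [hfac]
        rw [Finset.prod_univ_sum, Fintype.piFinset_univ]
    _ = _ := by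
        simp [signTensor, outerProduct, Finset.prod_mul_distrib, Finset.sum_apply]

open scoped Pointwise in
/-- The convex hull of the sign tensors absorbs every tensor, so that the infimum defining the
M-norm is over a nonempty set and carries no junk value. -/
lemma exists_mem_smul_convexHull_signAtoms {d N : ℕ} [NeZero N] (X : Tensor d N) :
    ∃ r : ℝ, 0 < r ∧ X ∈ r • convexHull ℝ (signAtoms d N) := by
  set s := convexHull ℝ (signAtoms d N)
  have hconv : Convex ℝ s := convex_convexHull ℝ _
  have hatom : ∀ u, signTensor u ∈ s := fun u =>
    subset_convexHull ℝ _ (signTensor_mem_signAtoms u)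
  have hadd : ∀ X Y : Tensor d N, (∃ r : ℝ, 0 < r ∧ X ∈ r • s) → (∃ r : ℝ, 0 < r ∧ Y ∈ r • s) →
      ∃ r : ℝ, 0 < r ∧ X + Y ∈ r • s := by
    rintro X Y ⟨r, hr, hX⟩ ⟨q, hq, hY⟩
    refine ⟨r + q, by positivity, ?_⟩
    rw [hconv.add_smul hr.le hq.le]
    exact Set.add_mem_add hX hY
  have hzero : ∃ r : ℝ, 0 < r ∧ (0 : Tensor d N) ∈ r • s := by
    have u : Fin d → Fin N → Bool := fun _ _ => true
    refine ⟨1 + 1, by norm_num, ?_⟩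
    rw [hconv.add_smul zero_le_one zero_le_one, one_smul]
    have h2 := hatom (!true, u)
    rw [signTensor_not] at h2
    rw [← add_neg_cancel (signTensor (true, u))]
    exact Set.add_mem_add (hatom _) h2
  have hpos : ∀ (c : ℝ) u, 0 < c → ∃ r : ℝ, 0 < r ∧ c • (signTensor u : Tensor d N) ∈ r • s :=
    fun c u hc => ⟨c, hc, Set.smul_mem_smul_set (hatom u)⟩
  have hsmul : ∀ (c : ℝ) u, ∃ r : ℝ, 0 < r ∧ c • (signTensor u : Tensor d N) ∈ r • s := by
    rintro c ⟨b, u⟩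
    rcases lt_trichotomy c 0 with hc | rfl | hc
    · have := hpos (-c) (!b, u) (neg_pos.2 hc)
      rwa [signTensor_not, neg_smul_neg] at this
    · rw [zero_smul]; exact hzero
    · exact hpos c _ hc
  have hX : X = ∑ i, ∑ δ : Fin d → Bool, (X i * (1 / 2 : ℝ) ^ d) •
      signTensor (true, fun j k => δ j || decide (k = i j)) := by
    conv_lhs => rw [← Finset.univ_sum_single X]
    refine Finset.sum_congr rfl fun i _ => ?_
    have : (Pi.single i (X i) : Tensor d N) = X i • (Pi.single i 1 : Tensor d N) := by
      rw [← Pi.single_smul]; simp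
    rw [this, single_eq_sum_signTensor, Finset.smul_sum]
    simp_rw [smul_smul]
  rw [hX]
  exact Finset.sum_induction _ (fun Y => ∃ r : ℝ, 0 < r ∧ Y ∈ r • s) hadd hzero fun i _ =>
    Finset.sum_induction _ (fun Y => ∃ r : ℝ, 0 < r ∧ Y ∈ r • s) hadd hzero fun δ _ => hsmul _ _

open scoped Pointwise in
/-- Duality between the M-norm and the maximum over rank-one sign tensors. -/
lemma linear_le_of_mNorm_le {d N : ℕ} [NeZero N] {R B : ℝ} {X : Tensor d N} (hX : mNorm X ≤ R)
    (L : Tensor d N →ₗ[ℝ] ℝ) (hL : ∀ u, L (signTensor u) ≤ B) : L X ≤ R * B := by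
  have hB : 0 ≤ B := by
    have h1 := hL (true, fun _ _ => true)
    have h2 := hL (!true, fun _ _ => true)
    rw [signTensor_not, map_neg] at h2
    linarith
  have hhull : ∀ c ∈ convexHull ℝ (signAtoms d N), L c ≤ B := by
    have hsub : convexHull ℝ (signAtoms d N) ⊆ {c | L c ≤ B} := by
      refine convexHull_min (fun T hT => ?_) (convex_halfSpace_le L.isLinear B)
      obtain ⟨u, rfl⟩ := exists_signTensor_of_mem_signAtoms hT
      exact hL u
    exact fun c hc => hsub hc
  have hr : ∀ r, R < r → L X ≤ r * B := by
    intro r hr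
    have hlt : sInf {r : ℝ | 0 < r ∧ X ∈ r • convexHull ℝ (signAtoms d N)} < r := hX.trans_lt hr
    obtain ⟨q, ⟨hq, c, hc, rfl⟩, hqr⟩ :=
      exists_lt_of_csInf_lt (exists_mem_smul_convexHull_signAtoms X) hlt
    simp only [map_smul, smul_eq_mul]
    have h1 := mul_le_mul_of_nonneg_left (hhull c hc) hq.le
    have h2 := mul_le_mul_of_nonneg_right hqr.le hB
    linarith
  refine le_of_forall_pos_le_add fun ε hε => ?_
  have h1 := hr (R + ε / (B + 1)) (by have : 0 < ε / (B + 1) := by positivity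
                                      linarith)
  have h2 : ε / (B + 1) * B ≤ ε := by
    rw [div_mul_eq_mul_div, div_le_iff₀ (by positivity)]
    nlinarith
  linarith [add_mul R (ε / (B + 1)) B]

/-- The linear functional `X ↦ ∑ₜ cₜ X (wₜ)` on the difference of two tensors of M-norm at most
`R`. -/
lemma sum_mul_sub_le_of_mNorm_le {d N m : ℕ} [NeZero N] {R B : ℝ} {X T : Tensor d N}
    (hX : mNorm X ≤ R) (hT : mNorm T ≤ R) (w : Fin m → Fin d → Fin N) (c : Fin m → ℝ)
    (hc : ∀ u, ∑ t, c t * signTensor u (w t) ≤ B) :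
    ∑ t, c t * (X (w t) - T (w t)) ≤ 2 * R * B := by
  set L : Tensor d N →ₗ[ℝ] ℝ := ∑ t, c t • LinearMap.proj (w t)
  have hL : ∀ Y, L Y = ∑ t, c t * Y (w t) := fun Y => by simp [L]
  have h1 := linear_le_of_mNorm_le hX L (fun u => (hL _).trans_le (hc u))
  have h2 := linear_le_of_mNorm_le (B := B) hT (-L) (fun u => by
    rw [LinearMap.neg_apply, ← map_neg, ← signTensor_not, hL]
    exact hc _)
  rw [LinearMap.neg_apply] at h2
  have h3 : ∑ t, c t * (X (w t) - T (w t)) = L X - L T := by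
    rw [hL, hL, ← Finset.sum_sub_distrib]
    simp_rw [mul_sub]
  linarith

lemma card_signTensor_index_le {d N : ℕ} (hd : 1 ≤ d) (hN : 1 ≤ N) :
    (Fintype.card (Bool × (Fin d → Fin N → Bool)) : ℝ) ≤ Real.exp (2 * ((d : ℝ) * N)) := by
  have h2 : (2 : ℝ) ≤ Real.exp 1 := by linarith [Real.add_one_le_exp 1]
  have hdN : 1 ≤ d * N := Nat.mul_pos hd hN
  have hcard : (Fintype.card (Bool × (Fin d → Fin N → Bool)) : ℝ) = 2 ^ (d * N + 1) := by
    simp [pow_succ, mul_comm 2, mul_comm d, pow_mul]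
  calc (Fintype.card (Bool × (Fin d → Fin N → Bool)) : ℝ) = 2 ^ (d * N + 1) := hcard
    _ ≤ 2 ^ (2 * (d * N)) := pow_le_pow_right₀ one_le_two (by omega)
    _ ≤ Real.exp 1 ^ (2 * (d * N)) := pow_le_pow_left₀ zero_le_two h2 _
    _ = Real.exp (2 * ((d : ℝ) * N)) := by rw [← Real.exp_nat_mul]; push_cast; ring_nf

/-! ### Contraction for exponential moments of Rademacher sums -/

/-- If `(x, y)` is weakly majorized by `(p, q)`, then the exponential sums compare. -/
lemma exp_add_exp_le_of_weak_majorization {x y p q : ℝ} (hx : x ≤ max p q) (hy : y ≤ max p q)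
    (hxy : x + y ≤ p + q) : Real.exp x + Real.exp y ≤ Real.exp p + Real.exp q := by
  wlog hpq : q ≤ p generalizing p q
  · rw [add_comm (Real.exp p)]
    rw [max_comm] at hx hy
    exact this hx hy (by linarith) (not_le.1 hpq).le
  rw [max_eq_left hpq] at hx hy
  rcases le_total x q with hxq | hxq
  · linarith [Real.exp_le_exp.2 hxq, Real.exp_le_exp.2 hy]
  -- `exp y ≤ exp (p + q - x)`, and `(exp p - exp x) * (1 - exp (q - x)) ≥ 0`
  have h1 : Real.exp y ≤ Real.exp (p + q - x) := Real.exp_le_exp.2 (by linarith)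
  have h2 : 0 ≤ (Real.exp p - Real.exp x) * (1 - Real.exp (q - x)) :=
    mul_nonneg (sub_nonneg.2 (Real.exp_le_exp.2 hx))
      (sub_nonneg.2 (Real.exp_le_one_iff.2 (by linarith)))
  have h3 : Real.exp p * Real.exp (q - x) = Real.exp (p + q - x) := by
    rw [← Real.exp_add]; ring_nf
  have h4 : Real.exp x * Real.exp (q - x) = Real.exp q := by
    rw [← Real.exp_add]; ring_nf
  linarith [sub_mul (Real.exp p) (Real.exp x) (1 - Real.exp (q - x)),
    mul_one_sub (Real.exp p) (Real.exp (q - x)), mul_one_sub (Real.exp x) (Real.exp (q - x))]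

/-- One step of the contraction principle: the coordinate `a` of a Rademacher sum is replaced by
a coordinate `b` that is smaller and varies less. -/
lemma exp_iSup_add_exp_iSup_sub_le {ι : Type*} [Nonempty ι] {u a b : ι → ℝ}
    (hp : BddAbove (Set.range fun i => u i + a i)) (hm : BddAbove (Set.range fun i => u i - a i))
    (hb : ∀ i, |b i| ≤ |a i|) (hbb : ∀ i j, |b i - b j| ≤ |a i - a j|) :
    Real.exp (⨆ i, u i + b i) + Real.exp (⨆ i, u i - b i) ≤
      Real.exp (⨆ i, u i + a i) + Real.exp (⨆ i, u i - a i) := by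
  have hp' := le_ciSup hp
  have hm' := le_ciSup hm
  have habs : ∀ i, u i + |a i| ≤ max (⨆ i, u i + a i) (⨆ i, u i - a i) := fun i => by
    rcases abs_cases (a i) with ⟨h, _⟩ | ⟨h, _⟩ <;> rw [h]
    · exact le_max_of_le_left (hp' i)
    · exact le_max_of_le_right (hm' i)
  refine exp_add_exp_le_of_weak_majorization (ciSup_le fun i => ?_) (ciSup_le fun i => ?_) ?_
  · linarith [habs i, hb i, le_abs_self (b i)]
  · linarith [habs i, hb i, neg_abs_le (b i)]
  · rw [← le_sub_iff_add_le]
    refine ciSup_le fun i => ?_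
    rw [le_sub_comm]
    refine ciSup_le fun j => ?_
    have h := (le_abs_self _).trans (hbb i j)
    have h1 := hp' i
    have h2 := hm' i
    have h3 := hp' j
    have h4 := hm' j
    rcases abs_cases (a i - a j) with ⟨h', _⟩ | ⟨h', _⟩ <;> rw [h'] at h <;> linarith

lemma bddAbove_range_of_abs_le {ι : Type*} {f : ι → ℝ} {A : ℝ} (h : ∀ i, |f i| ≤ A) :
    BddAbove (Set.range f) :=
  ⟨A, by rintro _ ⟨i, rfl⟩; exact (le_abs_self _).trans (h i)⟩

lemma abs_sum_boolSign_mul_le {κ : Type*} [Fintype κ] (ε : κ → Bool) {a : κ → ℝ} {A : ℝ}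
    (h : ∀ t, |a t| ≤ A) : |∑ t, boolSign (ε t) * a t| ≤ Fintype.card κ * A := by
  refine (Finset.abs_sum_le_sum_abs _ _).trans ?_
  refine (Finset.sum_le_card_nsmul _ _ A fun t _ => ?_).trans_eq (by simp)
  rw [abs_mul, abs_boolSign, one_mul]
  exact h t

/-- The contraction principle of Ledoux and Talagrand for exponential moments. -/
lemma sum_exp_iSup_rademacher_le {ι κ : Type*} [Nonempty ι] [Fintype κ] [DecidableEq κ]
    {a b : ι → κ → ℝ} {A : ℝ} (ha : ∀ i t, |a i t| ≤ A) (hb : ∀ i t, |b i t| ≤ |a i t|)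
    (hbb : ∀ i j t, |b i t - b j t| ≤ |a i t - a j t|) :
    ∑ ε : κ → Bool, Real.exp (⨆ i, ∑ t, boolSign (ε t) * b i t) ≤
      ∑ ε : κ → Bool, Real.exp (⨆ i, ∑ t, boolSign (ε t) * a i t) := by
  -- replace the coordinates in `s` one at a time
  have key : ∀ s : Finset κ,
      ∑ ε : κ → Bool, Real.exp (⨆ i, ∑ t, boolSign (ε t) * if t ∈ s then b i t else a i t) ≤
      ∑ ε : κ → Bool, Real.exp (⨆ i, ∑ t, boolSign (ε t) * a i t) := by
    intro s
    induction s using Finset.induction_on with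
    | empty => simp
    | insert k s hk ih =>
      refine le_trans ?_ ih
      -- the sign vectors are paired by flipping the sign at `k`
      have hinv : Function.Involutive fun ε : κ → Bool => Function.update ε k (!ε k) :=
        fun ε => by simp
      have hpair : ∀ F : (κ → Bool) → ℝ,
          2 * ∑ ε, F ε = ∑ ε, (F ε + F (Function.update ε k (!ε k))) := fun F => by
        rw [Finset.sum_add_distrib, two_mul]
        congr 1
        exact (Equiv.sum_comp hinv.toPerm F).symm
      refine le_of_mul_le_mul_left ?_ (zero_lt_two (α := ℝ))
      rw [hpair, hpair]
      refine Finset.sum_le_sum fun ε _ => ?_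
      set u : ι → ℝ := fun i =>
        ∑ t ∈ Finset.univ.erase k, boolSign (ε t) * if t ∈ s then b i t else a i t
      have hsplit : ∀ (δ : κ → Bool) (c : ι → κ → ℝ) (i : ι), (∀ t, t ≠ k → δ t = ε t) →
          (∀ t, t ≠ k → c i t = if t ∈ s then b i t else a i t) →
          ∑ t, boolSign (δ t) * c i t = u i + boolSign (δ k) * c i k := by
        intro δ c i hδ hc
        rw [← Finset.sum_erase_add _ _ (Finset.mem_univ k)]
        congr 1
        refine Finset.sum_congr rfl fun t ht => ?_
        rw [hδ t (Finset.ne_of_mem_erase ht), hc t (Finset.ne_of_mem_erase ht)]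
      have hins : ∀ i t, t ≠ k → (if t ∈ insert k s then b i t else a i t) =
          if t ∈ s then b i t else a i t := fun i t ht => by simp [ht]
      have hupd : ∀ t, t ≠ k → Function.update ε k (!ε k) t = ε t := fun t ht => by simp [ht]
      have e1 := fun i => hsplit ε (fun i t => if t ∈ insert k s then b i t else a i t) i
        (fun _ _ => rfl) (hins i)
      have e2 := fun i => hsplit (Function.update ε k (!ε k))
        (fun i t => if t ∈ insert k s then b i t else a i t) i hupd (hins i)
      have e3 := fun i => hsplit ε (fun i t => if t ∈ s then b i t else a i t) i
        (fun _ _ => rfl) (fun _ _ => rfl)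
      have e4 := fun i => hsplit (Function.update ε k (!ε k))
        (fun i t => if t ∈ s then b i t else a i t) i hupd (fun _ _ => rfl)
      have hbd : ∀ (δ : κ → Bool), BddAbove (Set.range fun i =>
          ∑ t, boolSign (δ t) * if t ∈ s then b i t else a i t) := fun δ =>
        bddAbove_range_of_abs_le fun i => abs_sum_boolSign_mul_le (A := A) δ fun t => by
          split_ifs
          · exact (hb i t).trans (ha i t)
          · exact ha i t
      have hbd1 := hbd ε
      have hbd2 := hbd (Function.update ε k (!ε k))
      simp only [e3] at hbd1
      simp only [e4] at hbd2
      simp only [e1, e2, e3, e4]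
      simp only [Finset.mem_insert_self, if_true, hk, if_false, Function.update_self] at hbd1 hbd2 ⊢
      cases hε : ε k
      · simp only [hε, boolSign_false, boolSign_true, Bool.not_false, neg_one_mul, one_mul,
          ← sub_eq_add_neg] at hbd1 hbd2 ⊢
        rw [add_comm, add_comm (Real.exp (⨆ i, u i - a i k))]
        exact exp_iSup_add_exp_iSup_sub_le hbd2 hbd1 (fun i => hb i k) fun i j => hbb i j k
      · simp only [hε, boolSign_false, boolSign_true, Bool.not_true, neg_one_mul, one_mul,
          ← sub_eq_add_neg] at hbd1 hbd2 ⊢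
        exact exp_iSup_add_exp_iSup_sub_le hbd1 hbd2 (fun i => hb i k) fun i j => hbb i j k
  simpa using key Finset.univ

lemma sum_exp_rademacher_le {κ : Type*} [Fintype κ] [DecidableEq κ] (c : ℝ) {v : κ → ℝ}
    (hv : ∀ t, |v t| = 1) :
    ∑ ε : κ → Bool, Real.exp (∑ t, boolSign (ε t) * (c * v t)) ≤
      2 ^ Fintype.card κ * Real.exp (Fintype.card κ * (c ^ 2 / 2)) := by
  simp_rw [Real.exp_sum]
  have h := Finset.prod_univ_sum (fun _ : κ => (Finset.univ : Finset Bool))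
    (fun t b => Real.exp (boolSign b * (c * v t)))
  rw [Fintype.piFinset_univ] at h
  rw [← h]
  have hfac : ∀ t, ∑ b : Bool, Real.exp (boolSign b * (c * v t)) = 2 * Real.cosh c := fun t => by
    rw [Real.cosh_eq]
    rcases eq_or_eq_neg_of_abs_eq (hv t) with h | h <;> simp [h] <;> ring
  simp_rw [hfac]
  rw [Finset.prod_const, Finset.card_univ, mul_pow]
  gcongr
  rw [Real.exp_nat_mul]
  exact pow_le_pow_left₀ (Real.cosh_pos c).le (Real.cosh_le_exp_half_sq c) _

/-! ### Symmetrization over a finite sample space -/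

section Symmetrization

variable {ι κ I : Type*} [Fintype κ] [DecidableEq κ] [Fintype I]

lemma sum_prod_weights_eq_one {q : I → ℝ} (hq : ∑ x, q x = 1) :
    ∑ w : κ → I, ∏ t, q (w t) = 1 := by
  have h := Finset.prod_univ_sum (fun _ : κ => (Finset.univ : Finset I)) (fun _ x => q x)
  rw [Fintype.piFinset_univ] at h
  rw [← h]
  simp [hq]

lemma sum_prod_weights_mul_apply {q : I → ℝ} (hq : ∑ x, q x = 1) (f : I → ℝ) (t : κ) :
    ∑ w : κ → I, (∏ s, q (w s)) * f (w t) = ∑ x, q x * f x := by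
  have h := Finset.prod_univ_sum (fun _ : κ => (Finset.univ : Finset I))
    (fun s x => q x * if s = t then f x else 1)
  rw [Fintype.piFinset_univ] at h
  simp only [Finset.prod_mul_distrib, Finset.prod_ite_eq', Finset.mem_univ, if_true] at h
  rw [← h, ← Finset.mul_prod_erase _ _ (Finset.mem_univ t), Finset.prod_eq_one fun s hs => ?_]
  · simp
  · simp [Finset.ne_of_mem_erase hs, hq]

/-- Jensen's inequality over an independent copy `w'` of the sample `w`. -/
lemma exp_iSup_le_sum_ghost [Nonempty ι] {q : I → ℝ} (hq0 : ∀ x, 0 ≤ q x) (hq : ∑ x, q x = 1)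
    {f : ι → I → ℝ} {A : ℝ} (hf : ∀ i x, |f i x| ≤ A) (w : κ → I) :
    Real.exp (⨆ i, ∑ t, (∑ x, q x * f i x - f i (w t))) ≤
      ∑ w' : κ → I, (∏ t, q (w' t)) * Real.exp (⨆ i, ∑ t, (f i (w' t) - f i (w t))) := by
  have hQ0 : ∀ w' : κ → I, 0 ≤ ∏ t, q (w' t) := fun w' => Finset.prod_nonneg fun t _ => hq0 _
  have hbd : ∀ w' : κ → I, BddAbove (Set.range fun i => ∑ t, (f i (w' t) - f i (w t))) :=
    fun w' => bddAbove_range_of_abs_le (A := Fintype.card κ * (A + A)) fun i => by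
      refine (Finset.abs_sum_le_sum_abs _ _).trans ?_
      refine (Finset.sum_le_card_nsmul _ _ (A + A) fun t _ => ?_).trans_eq (by simp [mul_add])
      exact (abs_sub _ _).trans (add_le_add (hf _ _) (hf _ _))
  have hJ := convexOn_exp.map_sum_le (t := Finset.univ) (w := fun w' : κ → I => ∏ t, q (w' t))
    (p := fun w' => ⨆ i, ∑ t, (f i (w' t) - f i (w t))) (fun w' _ => hQ0 w')
    (sum_prod_weights_eq_one hq) (fun _ _ => Set.mem_univ _)
  simp only [smul_eq_mul] at hJ
  refine le_trans (Real.exp_le_exp.2 (ciSup_le fun i => ?_)) hJ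
  calc ∑ t, (∑ x, q x * f i x - f i (w t))
      = ∑ t, ∑ w' : κ → I, (∏ s, q (w' s)) * (f i (w' t) - f i (w t)) := by
        refine Finset.sum_congr rfl fun t _ => ?_
        simp_rw [mul_sub]
        rw [Finset.sum_sub_distrib, sum_prod_weights_mul_apply hq, ← Finset.sum_mul,
          sum_prod_weights_eq_one hq, one_mul]
    _ = ∑ w' : κ → I, (∏ s, q (w' s)) * ∑ t, (f i (w' t) - f i (w t)) := by
        rw [Finset.sum_comm]; simp_rw [Finset.mul_sum]
    _ ≤ _ := Finset.sum_le_sum fun w' _ =>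
        mul_le_mul_of_nonneg_left (le_ciSup (hbd w') i) (hQ0 w')

/-- Exchanging `w t` and `w' t` at the places `t` where the sign is negative does not change the
joint law of a sample and its independent copy. -/
lemma sum_ghost_eq_sum_signed (q : I → ℝ) (f : ι → I → ℝ) (ε : κ → Bool) :
    ∑ w : κ → I, ∑ w' : κ → I, (∏ t, q (w t)) * (∏ t, q (w' t)) *
        Real.exp (⨆ i, ∑ t, (f i (w' t) - f i (w t))) =
      ∑ w : κ → I, ∑ w' : κ → I, (∏ t, q (w t)) * (∏ t, q (w' t)) *
        Real.exp (⨆ i, ∑ t, boolSign (ε t) * (f i (w' t) - f i (w t))) := by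
  have hinv : Function.Involutive fun z : (κ → I) × (κ → I) =>
      ((fun t => if ε t then z.1 t else z.2 t, fun t => if ε t then z.2 t else z.1 t) :
        (κ → I) × (κ → I)) := by
    intro z
    ext t <;> by_cases h : ε t <;> simp [h]
  rw [← Fintype.sum_prod_type', ← Fintype.sum_prod_type']
  rw [← Equiv.sum_comp hinv.toPerm]
  refine Finset.sum_congr rfl fun z _ => ?_
  simp only [Function.Involutive.coe_toPerm, ← Finset.prod_mul_distrib]
  congr 1
  · refine Finset.prod_congr rfl fun t _ => ?_
    by_cases h : ε t <;> simp [h, mul_comm]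
  · congr 2
    ext i
    refine Finset.sum_congr rfl fun t _ => ?_
    by_cases h : ε t <;> simp [h]

/-- Symmetrization of one-sided exponential moments of an empirical process. -/
lemma exp_moment_iSup_le_rademacher [Nonempty ι] {q : I → ℝ} (hq0 : ∀ x, 0 ≤ q x)
    (hq : ∑ x, q x = 1) {f : ι → I → ℝ} {A : ℝ} (hf : ∀ i x, |f i x| ≤ A) :
    2 ^ Fintype.card κ * ∑ w : κ → I, (∏ t, q (w t)) *
        Real.exp (⨆ i, ∑ t, (∑ x, q x * f i x - f i (w t))) ≤
      ∑ w : κ → I, (∏ t, q (w t)) *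
        ∑ ε : κ → Bool, Real.exp (⨆ i, ∑ t, boolSign (ε t) * (2 * f i (w t))) := by
  set Q : (κ → I) → ℝ := fun w => ∏ t, q (w t)
  have hQ0 : ∀ w, 0 ≤ Q w := fun w => Finset.prod_nonneg fun t _ => hq0 _
  have hQ : ∑ w, Q w = 1 := sum_prod_weights_eq_one hq
  set F : (κ → Bool) → (κ → I) → ℝ := fun ε w =>
    Real.exp (⨆ i, ∑ t, boolSign (ε t) * (2 * f i (w t)))
  have hbd : ∀ (ε : κ → Bool) (w : κ → I),
      BddAbove (Set.range fun i => ∑ t, boolSign (ε t) * (2 * f i (w t))) := fun ε w =>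
    bddAbove_range_of_abs_le fun i => abs_sum_boolSign_mul_le (A := 2 * A) ε fun t => by
      rw [abs_mul, abs_two]
      exact mul_le_mul_of_nonneg_left (hf _ _) zero_le_two
  -- the signed difference of the two samples splits by convexity of `exp`
  have hsplit : ∀ ε w w',
      Real.exp (⨆ i, ∑ t, boolSign (ε t) * (f i (w' t) - f i (w t))) ≤
        1 / 2 * F ε w' + 1 / 2 * F (fun t => !ε t) w := by
    intro ε w w'
    have hJ := convexOn_exp.2 (Set.mem_univ (⨆ i, ∑ t, boolSign (ε t) * (2 * f i (w' t))))
      (Set.mem_univ (⨆ i, ∑ t, boolSign (!ε t) * (2 * f i (w t))))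
      (one_half_pos (α := ℝ)).le (one_half_pos (α := ℝ)).le (add_halves 1)
    simp only [smul_eq_mul] at hJ
    refine le_trans (Real.exp_le_exp.2 (ciSup_le fun i => ?_)) hJ
    have h1 := le_ciSup (hbd ε w') i
    have h2 := le_ciSup (hbd (fun t => !ε t) w) i
    have h3 : ∑ t, boolSign (ε t) * (f i (w' t) - f i (w t)) =
        1 / 2 * ∑ t, boolSign (ε t) * (2 * f i (w' t)) +
          1 / 2 * ∑ t, boolSign (!ε t) * (2 * f i (w t)) := by
      rw [Finset.mul_sum, Finset.mul_sum, ← Finset.sum_add_distrib]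
      refine Finset.sum_congr rfl fun t _ => ?_
      rw [boolSign_not]; ring
    rw [h3]
    linarith
  have hstep : ∀ ε : κ → Bool, ∑ w, Q w * Real.exp (⨆ i, ∑ t, (∑ x, q x * f i x - f i (w t))) ≤
      1 / 2 * ∑ w, Q w * F ε w + 1 / 2 * ∑ w, Q w * F (fun t => !ε t) w := by
    intro ε
    calc ∑ w, Q w * Real.exp (⨆ i, ∑ t, (∑ x, q x * f i x - f i (w t)))
        ≤ ∑ w, ∑ w', Q w * Q w' * Real.exp (⨆ i, ∑ t, (f i (w' t) - f i (w t))) := by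
          refine Finset.sum_le_sum fun w _ => ?_
          simp_rw [mul_assoc]
          rw [← Finset.mul_sum]
          exact mul_le_mul_of_nonneg_left (exp_iSup_le_sum_ghost hq0 hq hf w) (hQ0 w)
      _ = ∑ w, ∑ w', Q w * Q w' *
            Real.exp (⨆ i, ∑ t, boolSign (ε t) * (f i (w' t) - f i (w t))) :=
          sum_ghost_eq_sum_signed q f ε
      _ ≤ ∑ w, ∑ w', Q w * Q w' * (1 / 2 * F ε w' + 1 / 2 * F (fun t => !ε t) w) :=
          Finset.sum_le_sum fun w _ => Finset.sum_le_sum fun w' _ =>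
            mul_le_mul_of_nonneg_left (hsplit ε w w') (mul_nonneg (hQ0 w) (hQ0 w'))
      _ = (∑ w, Q w) * (1 / 2 * ∑ w', Q w' * F ε w') +
            (∑ w', Q w') * (1 / 2 * ∑ w, Q w * F (fun t => !ε t) w) := by
          simp_rw [Finset.mul_sum, Finset.sum_mul, mul_add, Finset.sum_add_distrib]
          congr 1
          · rw [Finset.sum_comm]
            exact Finset.sum_congr rfl fun _ _ => Finset.sum_congr rfl fun _ _ => by ring
          · exact Finset.sum_congr rfl fun _ _ => Finset.sum_congr rfl fun _ _ => by ring
      _ = _ := by rw [hQ, one_mul, one_mul]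
  have hsum := Finset.sum_le_sum fun ε (_ : ε ∈ (Finset.univ : Finset (κ → Bool))) => hstep ε
  have hnot : Function.Involutive fun (ε : κ → Bool) t => !ε t := fun ε => by simp
  have hflip := Equiv.sum_comp hnot.toPerm fun ε => 1 / 2 * ∑ w, Q w * F ε w
  simp only [Function.Involutive.coe_toPerm] at hflip
  rw [Finset.sum_add_distrib, hflip, Finset.sum_const, Finset.card_univ, nsmul_eq_mul] at hsum
  have hcard : ((Fintype.card (κ → Bool) : ℕ) : ℝ) = 2 ^ Fintype.card κ := by simp
  rw [hcard] at hsum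
  refine hsum.trans_eq ?_
  rw [← Finset.mul_sum, ← add_mul, add_halves, one_mul, Finset.sum_comm]
  simp_rw [Finset.mul_sum]
  rfl

end Symmetrization

/-! ### Uniform deviation of the quadratic empirical process on the M-norm ball -/

/-- Exponential moment of the largest deviation of the empirical square loss below its mean over
the M-norm ball. After symmetrization, contraction removes the square at the cost of the entrywise
bound `2 * α` on `X - T`, and duality reduces the supremum to a maximum over sign tensors. -/
lemma exp_moment_sq_deviation_le {d N m : ℕ} (hd : 1 ≤ d) [NeZero N] {α R l : ℝ}
    (hα : 0 ≤ α) (hl : 0 ≤ l) {T : Tensor d N} (hT : T ∈ mNormBall d N α R)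
    {q : (Fin d → Fin N) → ℝ} (hq0 : ∀ x, 0 ≤ q x) (hq : ∑ x, q x = 1) :
    ∑ w : Fin m → Fin d → Fin N, (∏ t, q (w t)) * Real.exp (⨆ X : mNormBall d N α R,
        ∑ t, (∑ x, q x * (l * (X.1 x - T x) ^ 2) - l * (X.1 (w t) - T (w t)) ^ 2)) ≤
      Real.exp (2 * ((d : ℝ) * N) + m * (128 * (α * R * l) ^ 2)) := by
  have : Nonempty (mNormBall d N α R) := ⟨⟨T, hT⟩⟩
  have hD : ∀ (X : mNormBall d N α R) x, |X.1 x - T x| ≤ 2 * α := fun X x => by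
    have h1 := (norm_le_pi_norm X.1 x).trans X.2.1
    have h2 := (norm_le_pi_norm T x).trans hT.1
    rw [Real.norm_eq_abs] at h1 h2
    linarith [abs_sub (X.1 x) (T x)]
  have hf : ∀ (X : mNormBall d N α R) x, |l * (X.1 x - T x) ^ 2| ≤ l * (2 * α) ^ 2 :=
    fun X x => by
      rw [abs_mul, abs_of_nonneg hl, abs_pow]
      exact mul_le_mul_of_nonneg_left (pow_le_pow_left₀ (abs_nonneg _) (hD X x) 2) hl
  have hsym := exp_moment_iSup_le_rademacher (κ := Fin m) hq0 hq hf
  set E := Real.exp (2 * ((d : ℝ) * N) + m * (128 * (α * R * l) ^ 2))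
  have hrad : ∀ w : Fin m → Fin d → Fin N,
      ∑ ε : Fin m → Bool, Real.exp (⨆ X : mNormBall d N α R,
        ∑ t, boolSign (ε t) * (2 * (l * (X.1 (w t) - T (w t)) ^ 2))) ≤ 2 ^ m * E := by
    intro w
    have hcon := sum_exp_iSup_rademacher_le (κ := Fin m) (A := 8 * α * l * (2 * α))
      (a := fun (X : mNormBall d N α R) t => 8 * α * l * (X.1 (w t) - T (w t)))
      (b := fun X t => 2 * (l * (X.1 (w t) - T (w t)) ^ 2))
      (fun X t => by
        rw [abs_mul, abs_of_nonneg (by positivity : 0 ≤ 8 * α * l)]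
        exact mul_le_mul_of_nonneg_left (hD X _) (by positivity))
      (fun X t => by
        have h := hD X (w t)
        set D := X.1 (w t) - T (w t)
        calc |2 * (l * D ^ 2)| = 2 * l * (|D| * |D|) := by
              rw [← mul_assoc, abs_mul, abs_pow, abs_of_nonneg (by positivity : 0 ≤ 2 * l), sq]
          _ ≤ 2 * l * (2 * α * |D|) := by gcongr
          _ ≤ 8 * α * l * |D| := by nlinarith [mul_nonneg (mul_nonneg hα hl) (abs_nonneg D)]
          _ = |8 * α * l * D| := by
              rw [abs_mul (8 * α * l), abs_of_nonneg (by positivity : 0 ≤ 8 * α * l)])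
      (fun X Y t => by
        have hX := hD X (w t)
        have hY := hD Y (w t)
        set D := X.1 (w t) - T (w t)
        set D' := Y.1 (w t) - T (w t)
        calc |2 * (l * D ^ 2) - 2 * (l * D' ^ 2)| = 2 * l * (|D + D'| * |D - D'|) := by
              rw [← abs_mul, show 2 * (l * D ^ 2) - 2 * (l * D' ^ 2) = 2 * l * ((D + D') * (D - D'))
                by ring, abs_mul (2 * l), abs_of_nonneg (by positivity : 0 ≤ 2 * l)]
          _ ≤ 2 * l * (4 * α * |D - D'|) := by
              gcongr
              linarith [abs_add_le D D']
          _ = |8 * α * l * D - 8 * α * l * D'| := by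
              rw [← mul_sub, abs_mul (8 * α * l), abs_of_nonneg (by positivity : 0 ≤ 8 * α * l)]
              ring)
    refine hcon.trans ?_
    have hmax : ∀ ε : Fin m → Bool, Real.exp (⨆ X : mNormBall d N α R,
        ∑ t, boolSign (ε t) * (8 * α * l * (X.1 (w t) - T (w t)))) ≤
        ∑ u, Real.exp (∑ t, boolSign (ε t) * (16 * α * R * l * signTensor u (w t))) := by
      intro ε
      obtain ⟨u, -, hu⟩ := Finset.exists_max_image Finset.univ
        (fun u : Bool × (Fin d → Fin N → Bool) => ∑ t, boolSign (ε t) * signTensor u (w t))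
        Finset.univ_nonempty
      refine le_trans (Real.exp_le_exp.2 (ciSup_le fun X => ?_)) (Finset.single_le_sum
        (f := fun u => Real.exp (∑ t, boolSign (ε t) * (16 * α * R * l * signTensor u (w t))))
        (fun _ _ => (Real.exp_pos _).le) (Finset.mem_univ u))
      have h := sum_mul_sub_le_of_mNorm_le X.2.2 hT.2 w (fun t => boolSign (ε t))
        (fun u => hu u (Finset.mem_univ u))
      calc ∑ t, boolSign (ε t) * (8 * α * l * (X.1 (w t) - T (w t)))
          = 8 * α * l * ∑ t, boolSign (ε t) * (X.1 (w t) - T (w t)) := by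
            rw [Finset.mul_sum]; exact Finset.sum_congr rfl fun _ _ => by ring
        _ ≤ 8 * α * l * (2 * R * ∑ t, boolSign (ε t) * signTensor u (w t)) := by gcongr
        _ = _ := by
            rw [← mul_assoc, Finset.mul_sum]; exact Finset.sum_congr rfl fun _ _ => by ring
    calc _ ≤ ∑ ε : Fin m → Bool, ∑ u,
          Real.exp (∑ t, boolSign (ε t) * (16 * α * R * l * signTensor u (w t))) :=
          Finset.sum_le_sum fun ε _ => hmax ε
      _ = ∑ u, ∑ ε : Fin m → Bool,
          Real.exp (∑ t, boolSign (ε t) * (16 * α * R * l * signTensor u (w t))) :=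
          Finset.sum_comm
      _ ≤ ∑ _u : Bool × (Fin d → Fin N → Bool),
          2 ^ m * Real.exp (m * ((16 * α * R * l) ^ 2 / 2)) :=
          Finset.sum_le_sum fun u _ => by
            simpa using sum_exp_rademacher_le (16 * α * R * l)
              (v := fun t => signTensor u (w t)) fun t => abs_signTensor u _
      _ = 2 ^ m * (Fintype.card (Bool × (Fin d → Fin N → Bool)) *
            Real.exp (m * (128 * (α * R * l) ^ 2))) := by
          rw [Finset.sum_const, Finset.card_univ, nsmul_eq_mul,
            show (16 * α * R * l) ^ 2 / 2 = 128 * (α * R * l) ^ 2 by ring]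
          ring
      _ ≤ 2 ^ m * E := by
          rw [show E = _ from Real.exp_add _ _]
          gcongr
          exact card_signTensor_index_le hd NeZero.one_le
  rw [Fintype.card_fin] at hsym
  refine le_of_mul_le_mul_left (hsym.trans ?_) (pow_pos (zero_lt_two (α := ℝ)) m)
  calc _ ≤ ∑ w : Fin m → Fin d → Fin N, (∏ t, q (w t)) * (2 ^ m * E) :=
        Finset.sum_le_sum fun w _ =>
          mul_le_mul_of_nonneg_left (hrad w) (Finset.prod_nonneg fun t _ => hq0 _)
    _ = 2 ^ m * E := by rw [← Finset.sum_mul, sum_prod_weights_eq_one hq, one_mul]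

/-! ### Sub-exponential noise -/

lemma exp_sub_one_sub_self_le (x : ℝ) : Real.exp x - 1 - x ≤ x ^ 2 * Real.exp |x| := by
  have h1 : Real.exp x - 1 ≤ x * Real.exp x := by
    have h := mul_le_mul_of_nonneg_left (Real.one_sub_le_exp_neg x) (Real.exp_pos x).le
    rw [← Real.exp_add, add_neg_cancel, Real.exp_zero] at h
    linarith
  have h2 := Real.add_one_le_exp x
  rcases le_total 0 x with hx | hx
  · rw [abs_of_nonneg hx]
    nlinarith
  · rw [abs_of_nonpos hx]
    have h3 : 1 ≤ Real.exp (-x) := Real.one_le_exp (by linarith)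
    nlinarith [sq_nonneg x]

/-- The moment generating function of a centered sub-exponential variable is sub-Gaussian near
the origin. -/
lemma IsSubExponential.mgf_le {S : Type*} [MeasurableSpace S] {P : Measure S}
    [IsProbabilityMeasure P] {X : S → ℝ} {K l : ℝ} (hX : IsSubExponential P X K)
    (hmeas : Measurable X) (hmean : ∫ s, X s ∂P = 0) (hK : 0 < K) (hl : |l| * K ≤ 1 / 2) :
    Integrable (fun s => Real.exp (l * X s)) P ∧ mgf X P l ≤ Real.exp (22 * (l * K) ^ 2) := by
  obtain ⟨hint, hbound⟩ := hX
  have hIX : Integrable X P := by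
    refine (hint.const_mul K).mono' hmeas.aestronglyMeasurable (Filter.Eventually.of_forall
      fun s => ?_)
    have := Real.add_one_le_exp (|X s| / K)
    rw [Real.norm_eq_abs]
    calc |X s| = K * (|X s| / K) := by field_simp
      _ ≤ K * Real.exp (|X s| / K) := by gcongr; linarith
  have hpt : ∀ s, Real.exp (l * X s) ≤ 1 + l * X s + 8 * (l * K) ^ 2 * Real.exp (|X s| / K) := by
    intro s
    set y := |X s| / K
    have hy : 0 ≤ y := by positivity
    have hXy : |X s| = K * y := by simp only [y]; field_simp
    have hx : |l * X s| ≤ y / 2 := by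
      rw [abs_mul, hXy, ← mul_assoc]
      nlinarith
    have hq := Real.quadratic_le_exp_of_nonneg (by positivity : 0 ≤ y / 2)
    have h1 := exp_sub_one_sub_self_le (l * X s)
    have h2 : (l * X s) ^ 2 = (l * K) ^ 2 * y ^ 2 := by
      rw [mul_pow, ← sq_abs (X s), hXy]; ring
    have h3 : Real.exp y = Real.exp (y / 2) * Real.exp (y / 2) := by
      rw [← Real.exp_add, add_halves]
    have h4 : (l * X s) ^ 2 * Real.exp |l * X s| ≤ 8 * (l * K) ^ 2 * Real.exp y := by
      calc _ ≤ (l * X s) ^ 2 * Real.exp (y / 2) := by gcongr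
        _ = (l * K) ^ 2 * (y ^ 2 * Real.exp (y / 2)) := by rw [h2]; ring
        _ ≤ (l * K) ^ 2 * (8 * Real.exp (y / 2) * Real.exp (y / 2)) := by
            gcongr
            nlinarith
        _ = _ := by rw [h3]; ring
    linarith
  have hIlin : Integrable (fun s => 1 + l * X s) P := (integrable_const 1).add (hIX.const_mul l)
  have hIexp : Integrable (fun s => 8 * (l * K) ^ 2 * Real.exp (|X s| / K)) P := hint.const_mul _
  have hI : Integrable (fun s => Real.exp (l * X s)) P :=
    (hIlin.add hIexp).mono' (by fun_prop) (Filter.Eventually.of_forall fun s => by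
      rw [Real.norm_eq_abs, Real.abs_exp]; exact hpt s)
  refine ⟨hI, ?_⟩
  calc mgf X P l ≤ ∫ s, (1 + l * X s) + 8 * (l * K) ^ 2 * Real.exp (|X s| / K) ∂P :=
        integral_mono hI (hIlin.add hIexp) hpt
    _ = 1 + 8 * (l * K) ^ 2 * ∫ s, Real.exp (|X s| / K) ∂P := by
        rw [integral_add hIlin hIexp, integral_add (integrable_const 1) (hIX.const_mul l),
          integral_const_mul, integral_const_mul, hmean]
        simp
    _ ≤ 1 + 8 * (l * K) ^ 2 * Real.exp 1 := by gcongr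
    _ ≤ 22 * (l * K) ^ 2 + 1 := by nlinarith [Real.exp_one_lt_d9, sq_nonneg (l * K)]
    _ ≤ _ := Real.add_one_le_exp _

/-- Bernstein-type tail bound for signed sums of independent centered sub-exponential variables. -/
lemma measureReal_signed_sum_gt_le {S : Type*} [MeasurableSpace S] {P : Measure S}
    [IsProbabilityMeasure P] {m : ℕ} {ξ : Fin m → S → ℝ} {K l B : ℝ} (hK : 0 < K)
    (hmeas : ∀ t, Measurable (ξ t)) (hmean : ∀ t, ∫ s, ξ t s ∂P = 0)
    (hsub : ∀ t, IsSubExponential P (ξ t) K) (hind : iIndepFun ξ P) {c : Fin m → ℝ}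
    (hc : ∀ t, |c t| = 1) (hl0 : 0 ≤ l) (hl : l * K ≤ 1 / 2) :
    P.real {s | B < ∑ t, ξ t s * c t} ≤ Real.exp (-l * B + m * (22 * (l * K) ^ 2)) := by
  have hlc : ∀ t, |l * c t| * K ≤ 1 / 2 := fun t => by
    rwa [abs_mul, hc, mul_one, abs_of_nonneg hl0]
  have hmgf := fun t => (hsub t).mgf_le (hmeas t) (hmean t) hK (hlc t)
  have hind' : iIndepFun (fun t s => c t * ξ t s) P :=
    hind.comp (fun t x => c t * x) fun t => measurable_const_mul (c t)
  have hmeas' : ∀ t, Measurable fun s => c t * ξ t s := fun t => (hmeas t).const_mul _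
  have hint : Integrable (fun s => Real.exp (l * (∑ t, fun s => c t * ξ t s) s)) P :=
    hind'.integrable_exp_mul_sum hmeas' fun t _ => by
      simpa only [mul_assoc] using (hmgf t).1
  have hch := measure_ge_le_exp_mul_mgf (μ := P) B hl0 hint
  refine le_trans (measureReal_mono fun s hs => ?_) (hch.trans ?_)
  · have hs' : B < ∑ t, ξ t s * c t := hs
    simpa [Finset.sum_apply, mul_comm (c _)] using hs'.le
  · rw [Real.exp_add]
    gcongr
    rw [hind'.mgf_sum hmeas', Real.exp_nat_mul]
    refine (Finset.prod_le_prod (g := fun _ => Real.exp (22 * (l * K) ^ 2)) (fun t _ => mgf_nonneg)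
      fun t _ => ?_).trans_eq (by simp)
    rw [mgf_const_mul, mul_comm]
    refine (hmgf t).2.trans_eq ?_
    rw [mul_right_comm, mul_pow _ (c t), ← sq_abs (c t), hc, one_pow, mul_one]

/-! ### The two exceptional events -/

section Events

variable {d N m : ℕ} {S : Type*} [MeasurableSpace S] {P : Measure S}
  {p : PMF (Fin d → Fin N)} {ω : Fin m → S → Fin d → Fin N}

lemma sum_toReal_pmf_eq_one {I : Type*} [Fintype I] (p : PMF I) : ∑ x, (p x).toReal = 1 := by
  have h : ∑ x, p x = 1 := by rw [← tsum_fintype (L := .unconditional I), p.tsum_coe]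
  rw [← ENNReal.toReal_sum fun x _ => p.apply_ne_top x, h, ENNReal.toReal_one]

lemma measureReal_sample_eq_prod (hω : ∀ t, Measurable (ω t))
    (hlaw : ∀ t, P.map (ω t) = p.toMeasure) (hind : iIndepFun ω P) (w : Fin m → Fin d → Fin N) :
    P.real {s | (fun t => ω t s) = w} = ∏ t, (p (w t)).toReal := by
  have hset : {s | (fun t => ω t s) = w} = ⋂ t ∈ Finset.univ, ω t ⁻¹' {w t} := by
    ext s; simp [funext_iff]
  rw [measureReal_def, hset, hind.measure_inter_preimage_eq_mul Finset.univ
    (fun t _ => measurableSet_singleton _), ENNReal.toReal_prod]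
  refine Finset.prod_congr rfl fun t _ => ?_
  rw [← Measure.map_apply (hω t) (measurableSet_singleton _), hlaw,
    PMF.toMeasure_apply_singleton _ _ (measurableSet_singleton _)]

/-- With high probability the empirical square loss is not far below its mean, uniformly over the
M-norm ball. -/
lemma measureReal_sq_deviation_gt_le [IsProbabilityMeasure P] (hd : 1 ≤ d) [NeZero N]
    {α R l z : ℝ} (hα : 0 ≤ α) (hl : 0 ≤ l) {T : Tensor d N} (hT : T ∈ mNormBall d N α R)
    (hω : ∀ t, Measurable (ω t)) (hlaw : ∀ t, P.map (ω t) = p.toMeasure) (hind : iIndepFun ω P) :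
    P.real {s | ∃ X ∈ mNormBall d N α R, z < ∑ t, (∑ x, (p x).toReal * (X x - T x) ^ 2 -
        (X (ω t s) - T (ω t s)) ^ 2)} ≤
      Real.exp (2 * ((d : ℝ) * N) + m * (128 * (α * R * l) ^ 2) - l * z) := by
  classical
  set q : (Fin d → Fin N) → ℝ := fun x => (p x).toReal
  have hq0 : ∀ x, 0 ≤ q x := fun x => ENNReal.toReal_nonneg
  have hq : ∑ x, q x = 1 := sum_toReal_pmf_eq_one p
  have hQ0 : ∀ w : Fin m → Fin d → Fin N, 0 ≤ ∏ t, q (w t) := fun w =>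
    Finset.prod_nonneg fun t _ => hq0 _
  set Z : mNormBall d N α R → (Fin m → Fin d → Fin N) → ℝ := fun X w =>
    ∑ t, (∑ x, q x * (l * (X.1 x - T x) ^ 2) - l * (X.1 (w t) - T (w t)) ^ 2)
  have hD : ∀ (X : mNormBall d N α R) x, (X.1 x - T x) ^ 2 ≤ (2 * α) ^ 2 := fun X x => by
    have h1 := (norm_le_pi_norm X.1 x).trans X.2.1
    have h2 := (norm_le_pi_norm T x).trans hT.1
    rw [Real.norm_eq_abs] at h1 h2
    rw [← sq_abs]
    exact pow_le_pow_left₀ (abs_nonneg _) (by linarith [abs_sub (X.1 x) (T x)]) 2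
  have hbd : ∀ w, BddAbove (Set.range fun X => Z X w) := by
    intro w
    refine ⟨∑ _t : Fin m, ∑ x, q x * (l * (2 * α) ^ 2), ?_⟩
    rintro _ ⟨X, rfl⟩
    refine Finset.sum_le_sum fun t _ => (sub_le_self _ (by positivity)).trans ?_
    exact Finset.sum_le_sum fun x _ =>
      mul_le_mul_of_nonneg_left (mul_le_mul_of_nonneg_left (hD X x) hl) (hq0 x)
  set E : Finset (Fin m → Fin d → Fin N) := Finset.univ.filter fun w =>
    ∃ X ∈ mNormBall d N α R, z < ∑ t, (∑ x, q x * (X x - T x) ^ 2 - (X (w t) - T (w t)) ^ 2)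
  have hE : ∀ w ∈ E, l * z ≤ ⨆ X, Z X w := by
    intro w hw
    obtain ⟨X, hX, hz⟩ := (Finset.mem_filter.1 hw).2
    refine le_trans ?_ (le_ciSup (hbd w) ⟨X, hX⟩)
    refine (mul_le_mul_of_nonneg_left hz.le hl).trans_eq ?_
    simp only [Z, Finset.mul_sum, mul_sub]
    refine Finset.sum_congr rfl fun t _ => ?_
    congr 1
    exact Finset.sum_congr rfl fun x _ => by ring
  calc P.real {s | ∃ X ∈ mNormBall d N α R, z < ∑ t, (∑ x, q x * (X x - T x) ^ 2 -
        (X (ω t s) - T (ω t s)) ^ 2)}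
      ≤ P.real (⋃ w ∈ E, {s | (fun t => ω t s) = w}) := by
        refine measureReal_mono (fun s hs => ?_) (measure_ne_top _ _)
        exact Set.mem_biUnion (x := fun t => ω t s)
          (Finset.mem_coe.2 (Finset.mem_filter.2 ⟨Finset.mem_univ _, hs⟩)) rfl
    _ ≤ ∑ w ∈ E, ∏ t, q (w t) := by
        refine (measureReal_biUnion_finset_le _ _).trans_eq ?_
        exact Finset.sum_congr rfl fun w _ => measureReal_sample_eq_prod hω hlaw hind w
    _ ≤ ∑ w ∈ E, (∏ t, q (w t)) * Real.exp (⨆ X, Z X w) * Real.exp (-(l * z)) := by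
        refine Finset.sum_le_sum fun w hw => ?_
        rw [mul_assoc, ← Real.exp_add]
        exact le_mul_of_one_le_right (hQ0 w) (Real.one_le_exp (by linarith [hE w hw]))
    _ ≤ ∑ w, (∏ t, q (w t)) * Real.exp (⨆ X, Z X w) * Real.exp (-(l * z)) :=
        Finset.sum_le_sum_of_subset_of_nonneg (Finset.subset_univ _) fun w _ _ =>
          mul_nonneg (mul_nonneg (hQ0 w) (Real.exp_pos _).le) (Real.exp_pos _).le
    _ ≤ Real.exp (2 * ((d : ℝ) * N) + m * (128 * (α * R * l) ^ 2)) * Real.exp (-(l * z)) := by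
        rw [← Finset.sum_mul]
        gcongr
        exact exp_moment_sq_deviation_le hd hα hl hT hq0 hq
    _ = _ := by rw [← Real.exp_add, sub_eq_add_neg]

/-- With high probability the noise, tested on the sampled entries, is almost orthogonal to every
rank-one sign tensor. The independence of noise and sample allows conditioning on the sample. -/
lemma measureReal_noise_gt_le [IsProbabilityMeasure P] (hd : 1 ≤ d) [NeZero N]
    {ξ : Fin m → S → ℝ} {K l B : ℝ} (hK : 0 < K) (hl0 : 0 ≤ l) (hl : l * K ≤ 1 / 2)
    (hω : ∀ t, Measurable (ω t)) (hlaw : ∀ t, P.map (ω t) = p.toMeasure) (hind : iIndepFun ω P)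
    (hmeas : ∀ t, Measurable (ξ t)) (hmean : ∀ t, ∫ s, ξ t s ∂P = 0)
    (hsub : ∀ t, IsSubExponential P (ξ t) K) (hindξ : iIndepFun ξ P)
    (hωξ : IndepFun (fun s t => ω t s) (fun s t => ξ t s) P) :
    P.real {s | ∃ u : Bool × (Fin d → Fin N → Bool), B < ∑ t, ξ t s * signTensor u (ω t s)} ≤
      Real.exp (2 * ((d : ℝ) * N) + m * (22 * (l * K) ^ 2) - l * B) := by
  have hone : ∀ (u : Bool × (Fin d → Fin N → Bool)) (w : Fin m → Fin d → Fin N),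
      P.real {s | (fun t => ω t s) = w ∧ B < ∑ t, ξ t s * signTensor u (w t)} ≤
        (∏ t, (p (w t)).toReal) * Real.exp (-l * B + m * (22 * (l * K) ^ 2)) := by
    intro u w
    have hset : MeasurableSet {x : Fin m → ℝ | B < ∑ t, x t * signTensor u (w t)} :=
      measurableSet_lt measurable_const (by fun_prop)
    have h := hωξ.measure_inter_preimage_eq_mul {w} _ (measurableSet_singleton w) hset
    have h' : P.real {s | (fun t => ω t s) = w ∧ B < ∑ t, ξ t s * signTensor u (w t)} =
        P.real {s | (fun t => ω t s) = w} * P.real {s | B < ∑ t, ξ t s * signTensor u (w t)} := by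
      rw [measureReal_def, measureReal_def, measureReal_def, ← ENNReal.toReal_mul]
      exact congrArg ENNReal.toReal h
    rw [h', measureReal_sample_eq_prod hω hlaw hind]
    refine mul_le_mul_of_nonneg_left ?_ (Finset.prod_nonneg fun _ _ => ENNReal.toReal_nonneg)
    exact measureReal_signed_sum_gt_le hK hmeas hmean hsub hindξ (fun t => abs_signTensor u _)
      hl0 hl
  calc P.real {s | ∃ u : Bool × (Fin d → Fin N → Bool), B < ∑ t, ξ t s * signTensor u (ω t s)}
      ≤ P.real (⋃ u ∈ (Finset.univ : Finset (Bool × (Fin d → Fin N → Bool))),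
          ⋃ w ∈ (Finset.univ : Finset (Fin m → Fin d → Fin N)),
          {s | (fun t => ω t s) = w ∧ B < ∑ t, ξ t s * signTensor u (w t)}) := by
        refine measureReal_mono (fun s hs => ?_) (measure_ne_top _ _)
        obtain ⟨u, hu⟩ := hs
        simp only [Finset.mem_univ, Set.iUnion_true, Set.mem_iUnion]
        exact ⟨u, fun t => ω t s, rfl, hu⟩
    _ ≤ ∑ _u : Bool × (Fin d → Fin N → Bool), ∑ w : Fin m → Fin d → Fin N,
          (∏ t, (p (w t)).toReal) * Real.exp (-l * B + m * (22 * (l * K) ^ 2)) := by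
        refine (measureReal_biUnion_finset_le _ _).trans (Finset.sum_le_sum fun u _ => ?_)
        exact (measureReal_biUnion_finset_le _ _).trans (Finset.sum_le_sum fun w _ => hone u w)
    _ = Fintype.card (Bool × (Fin d → Fin N → Bool)) *
          Real.exp (-l * B + m * (22 * (l * K) ^ 2)) := by
        rw [← Finset.sum_mul, sum_prod_weights_eq_one (sum_toReal_pmf_eq_one p), one_mul,
          Finset.sum_const, Finset.card_univ, nsmul_eq_mul]
    _ ≤ Real.exp (2 * ((d : ℝ) * N)) * Real.exp (-l * B + m * (22 * (l * K) ^ 2)) := by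
        gcongr
        exact card_signTensor_index_le hd NeZero.one_le
    _ = _ := by rw [← Real.exp_add]; ring_nf

end Events

/-! ### The error bound -/

/-- The basic inequality: comparing the losses of the estimator and of the true tensor bounds the
squared prediction error by the noise tested on the error. -/
lemma sum_sq_le_of_isMNormEstimator {d N m : ℕ} (hm : 0 < m) {α R σ : ℝ}
    {T X : Tensor d N} {w : Fin m → Fin d → Fin N} {e : Fin m → ℝ} (hT : T ∈ mNormBall d N α R)
    (hX : IsMNormEstimator α R w (fun t => T (w t) + σ * e t) X) :
    ∑ t, (X (w t) - T (w t)) ^ 2 ≤ 2 * σ * ∑ t, e t * (X (w t) - T (w t)) := by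
  have h : empiricalLoss w (fun t => T (w t) + σ * e t) X ≤
      empiricalLoss w (fun t => T (w t) + σ * e t) T := hX.2 hT
  have hm' : (0 : ℝ) < 1 / m := by positivity
  have h' := le_of_mul_le_mul_left h hm'
  have hexp : ∑ t, (X (w t) - (T (w t) + σ * e t)) ^ 2 = ∑ t, (X (w t) - T (w t)) ^ 2 -
      2 * σ * ∑ t, e t * (X (w t) - T (w t)) + ∑ t, (T (w t) - (T (w t) + σ * e t)) ^ 2 := by
    rw [Finset.mul_sum, ← Finset.sum_sub_distrib, ← Finset.sum_add_distrib]
    exact Finset.sum_congr rfl fun t _ => by ring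
  linarith

/-- The error bound outside the two exceptional events. -/
lemma frobeniusSq_le_of_isMNormEstimator {d N m : ℕ} [NeZero N] (hm : 0 < m)
    {α R σ μ B z : ℝ} (hσ : 0 ≤ σ) (hμ : 0 < μ) {T X : Tensor d N} {w : Fin m → Fin d → Fin N}
    {e : Fin m → ℝ} {q : (Fin d → Fin N) → ℝ} (hq : ∀ i, 1 / (μ * (N : ℝ) ^ d) ≤ q i)
    (hT : T ∈ mNormBall d N α R) (hX : IsMNormEstimator α R w (fun t => T (w t) + σ * e t) X)
    (hnoise : ∀ u, ∑ t, e t * signTensor u (w t) ≤ B)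
    (hdev : ∑ t, (∑ x, q x * (X x - T x) ^ 2 - (X (w t) - T (w t)) ^ 2) ≤ z) :
    (1 / (N : ℝ) ^ d) * frobeniusSq (X - T) ≤ μ * ((4 * σ * R * B + z) / m) := by
  have h1 := sum_sq_le_of_isMNormEstimator hm hT hX
  have h2 := sum_mul_sub_le_of_mNorm_le hX.1.2 hT.2 w e hnoise
  have h3 := mul_le_mul_of_nonneg_left h2 (mul_nonneg zero_le_two hσ)
  rw [Finset.sum_sub_distrib, Finset.sum_const, Finset.card_univ, Fintype.card_fin,
    nsmul_eq_mul] at hdev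
  have hm' : (0 : ℝ) < m := Nat.cast_pos.2 hm
  have h4 : ∑ x, q x * (X x - T x) ^ 2 ≤ (4 * σ * R * B + z) / m := by
    rw [le_div_iff₀ hm']
    linarith
  have hN : (0 : ℝ) < N := Nat.cast_pos.2 (NeZero.pos N)
  calc (1 / (N : ℝ) ^ d) * frobeniusSq (X - T)
      = μ * ∑ x, 1 / (μ * (N : ℝ) ^ d) * (X x - T x) ^ 2 := by
        rw [← Finset.mul_sum, ← mul_assoc]
        congr 1
        field_simp
    _ ≤ μ * ∑ x, q x * (X x - T x) ^ 2 := by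
        gcongr with x
        exact hq x
    _ ≤ _ := by gcongr

lemma exp_neg_two_mul_lt {d N : ℕ} (hd : 1 ≤ d) (hN : 2 ≤ N) :
    Real.exp (-(2 * ((d : ℝ) * N))) < Real.exp (-((N : ℝ) / Real.log N)) := by
  have hN' : (2 : ℝ) ≤ N := by exact_mod_cast hN
  have hd' : (1 : ℝ) ≤ d := by exact_mod_cast hd
  have hlog : 1 / 2 < Real.log N := by
    have := Real.log_le_log zero_lt_two hN'
    linarith [Real.log_two_gt_d9]
  refine Real.exp_lt_exp.2 (neg_lt_neg ?_)
  rw [div_lt_iff₀ (by linarith)]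
  have h1 : (N : ℝ) ≤ d * N := le_mul_of_one_le_left (by linarith) hd'
  nlinarith

theorem mainTheorem9 :
    ∃ C : ℝ, 0 < C ∧
      ∀ (d N m : ℕ), 1 ≤ d → 2 ≤ N → d * N < m →
      ∀ (α R σ K μ : ℝ), α ≤ R → 0 < σ → 0 < K → 1 ≤ μ →
      -- the unknown tensor
      ∀ (T : Tensor d N), ‖T‖ ≤ α → mNorm T ≤ R →
      -- the sampling distribution on multi-indices
      ∀ (p : PMF (Fin d → Fin N)), (∀ i, 1 / (μ * (N : ℝ) ^ d) ≤ (p i).toReal) →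
      ∀ (S : Type*) [MeasurableSpace S] (P : Measure S) [IsProbabilityMeasure P]
        (ω : Fin m → S → (Fin d → Fin N)) (ξ : Fin m → S → ℝ),
      -- independent samples with law `p`
      (∀ t, Measurable (ω t)) → (∀ t, P.map (ω t) = p.toMeasure) → iIndepFun ω P →
      -- independent centered sub-exponential noise, independent of the samples
      (∀ t, Measurable (ξ t)) → (∀ t, ∫ s, ξ t s ∂P = 0) →
      (∀ t, IsSubExponential P (ξ t) K) → iIndepFun ξ P →
      IndepFun (fun s t => ω t s) (fun s t => ξ t s) P →
      -- the estimator from the observations `T (ω t) + σ * ξ t`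
      ∀ (That : S → Tensor d N),
      (∀ᵐ s ∂P, IsMNormEstimator α R (fun t => ω t s)
        (fun t => T (ω t s) + σ * ξ t s) (That s)) →
      P {s | ¬ ((1 / (N : ℝ) ^ d) * frobeniusSq (That s - T)
            ≤ C * μ * (α + σ * K) * R * √((d : ℝ) * N / m))}
        < ENNReal.ofReal (2 * Real.exp (-((N : ℝ) / Real.log N))) := by
  -- the noise level `19 * K * (m * r)` below, with `r = √(d * N / m)`, contributes `4 * 19 = 76`
  refine ⟨76, by norm_num, ?_⟩
  intro d N m hd hN hm α R σ K μ hαR hσ hK hμ T hTα hTR p hp S _ P _ ω ξ hω hlaw hind hξ hmean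
    hsub hindξ hωξ That hThat
  have : NeZero N := ⟨by omega⟩
  have hm0 : 0 < m := by omega
  have hm' : (0 : ℝ) < m := Nat.cast_pos.2 hm0
  have hα : 0 ≤ α := (norm_nonneg T).trans hTα
  have hR : 0 ≤ R := hα.trans hαR
  have hμ0 : 0 < μ := by linarith
  have hT : T ∈ mNormBall d N α R := ⟨hTα, hTR⟩
  have hdN : 0 < d * N := Nat.mul_pos hd (by omega)
  have hdN' : (0 : ℝ) < (d : ℝ) * N := by exact_mod_cast hdN
  set r := √((d : ℝ) * N / m)
  have hr0 : 0 < r := Real.sqrt_pos.2 (by positivity)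
  have hr2 : m * r ^ 2 = (d : ℝ) * N := by
    rw [Real.sq_sqrt (by positivity)]; field_simp
  have hr1 : r ≤ 1 := by
    refine Real.sqrt_le_one.2 ?_
    rw [div_le_one hm']
    exact_mod_cast hm.le
  rcases hα.eq_or_lt with hα0 | hα0
  · -- if `α = 0`, both tensors vanish
    have hnull : P {s | ¬ ((1 / (N : ℝ) ^ d) * frobeniusSq (That s - T)
        ≤ 76 * μ * (α + σ * K) * R * r)} = 0 := by
      refine ae_iff.1 (hThat.mono fun s hs => ?_)
      have h1 : T = 0 := norm_le_zero_iff.1 (hTα.trans_eq hα0.symm)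
      have h2 : That s = 0 := norm_le_zero_iff.1 (hs.1.1.trans_eq hα0.symm)
      rw [h1, h2]
      simp only [frobeniusSq, sub_self, Pi.zero_apply]
      have : 0 ≤ 76 * μ * (α + σ * K) * R * r := by positivity
      simpa using this
    rw [hnull]
    exact ENNReal.ofReal_pos.2 (by positivity)
  have hRpos : 0 < R := hα0.trans_le hαR
  -- the levels `19` and `48` make both failure probabilities `exp (-2 * d * N)`;
  -- both Chernoff parameters are proportional to `r`, so that the exponents are multiples of
  -- `m * r ^ 2 = d * N`
  have hE1 := measureReal_noise_gt_le (B := 19 * K * (m * r)) (l := r / (2 * K)) hd hK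
    (by positivity) (by rw [div_mul_eq_mul_div, div_le_div_iff₀ (by positivity) two_pos]; nlinarith)
    hω hlaw hind hξ hmean hsub hindξ hωξ
  have hE2 := measureReal_sq_deviation_gt_le (P := P) (z := 48 * (α * R) * (m * r))
    (l := r / (8 * (α * R))) hd hα (by positivity) hT hω hlaw hind
  have he1 : 2 * ((d : ℝ) * N) + m * (22 * (r / (2 * K) * K) ^ 2) -
      r / (2 * K) * (19 * K * (m * r)) = -(2 * ((d : ℝ) * N)) := by
    rw [← hr2]; field_simp; ring
  have he2 : 2 * ((d : ℝ) * N) + m * (128 * (α * R * (r / (8 * (α * R)))) ^ 2) -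
      r / (8 * (α * R)) * (48 * (α * R) * (m * r)) = -(2 * ((d : ℝ) * N)) := by
    rw [← hr2]; field_simp; ring
  rw [he1] at hE1
  rw [he2] at hE2
  set E1 := {s | ∃ u : Bool × (Fin d → Fin N → Bool),
    19 * K * (m * r) < ∑ t, ξ t s * signTensor u (ω t s)}
  set E2 := {s | ∃ X ∈ mNormBall d N α R, 48 * (α * R) * (m * r) <
    ∑ t, (∑ x, (p x).toReal * (X x - T x) ^ 2 - (X (ω t s) - T (ω t s)) ^ 2)}
  have hgood : ∀ᵐ s ∂P, s ∈ {s | ¬ ((1 / (N : ℝ) ^ d) * frobeniusSq (That s - T)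
      ≤ 76 * μ * (α + σ * K) * R * r)} → s ∈ E1 ∪ E2 := by
    filter_upwards [hThat] with s hs hbad
    by_contra hnot
    rw [Set.mem_union, not_or] at hnot
    refine hbad ?_
    have h1 : ∀ u, ∑ t, ξ t s * signTensor u (ω t s) ≤ 19 * K * (m * r) := fun u =>
      not_lt.1 fun h => hnot.1 ⟨u, h⟩
    have h2 : ∑ t, (∑ x, (p x).toReal * (That s x - T x) ^ 2 -
        (That s (ω t s) - T (ω t s)) ^ 2) ≤ 48 * (α * R) * (m * r) :=
      not_lt.1 fun h => hnot.2 ⟨That s, hs.1, h⟩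
    refine (frobeniusSq_le_of_isMNormEstimator hm0 hσ.le hμ0 hp hT hs h1 h2).trans ?_
    have h3 : (4 * σ * R * (19 * K * (m * r)) + 48 * (α * R) * (m * r)) / m =
        (76 * (σ * K) + 48 * α) * R * r := by
      field_simp; ring
    rw [h3]
    calc μ * ((76 * (σ * K) + 48 * α) * R * r) ≤ μ * ((76 * (σ * K) + 76 * α) * R * r) := by
          gcongr; norm_num
      _ = _ := by ring
  calc _ ≤ P (E1 ∪ E2) := measure_mono_ae hgood
    _ = ENNReal.ofReal (P.real (E1 ∪ E2)) := (ofReal_measureReal).symm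
    _ < _ := by
      refine (ENNReal.ofReal_lt_ofReal_iff (by positivity)).2 ?_
      linarith [measureReal_union_le (μ := P) E1 E2, exp_neg_two_mul_lt hd hN]
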